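/- Let $d,s$ be positive integers, $p$ an odd prime, and $r$ an integer such that $d+p^s-dp^s\le r\le p^s$, $\gcd(p,d)=1$ and $p^s\equiv r\pmod d$. Write $(x)_n=x(x+1)\cdots(x+n-1)$ (with $(x)_0=1$) and $N=(p^s-r)/d$, and let $m=N$ or $m=p^s-1$. Then, modulo $p^{s+4}$, $$\sum_{k=0}^{m}(2dk+r)\frac{(r/d)_k^6}{k!^6}\equiv\frac{1}{(1)_{N}}\sum_{k=0}^{N}\frac{(2r/d)_{N}}{(2r/d)_k}\,\frac{(r/d)_k^3(1-r/d)_k}{k!^3}\bigg\{p^s-p^{3s}\sum_{j=1}^{k}\bigg(\frac{1}{(dj)^2}+\frac{1}{(dj-d+r)^2}\bigg)\bigg\}.$$ Here the quotient $(2r/d)_N/(2r/d)_k$ denotes the product $\prod_{i=k}^{N-1}\big(\tfrac{2r}{d}+i\big)$, also when $(2r/d)_k=0$ (which can happen only for $d=2$, $r<0$), and a congruence $A\equiv B\pmod{p^{e}}$ between rational numbers means that $A-B$ is $p^{e}$ times a rational number whose denominator is prime to $p$. -/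

import Mathlib

/-- The shifted factorial `(x)_n = Γ(x+n)/Γ(x) = x (x+1) ⋯ (x+n-1)` of a rational number `x`,
with `(x)_0 = 1`. -/
noncomputable def shiftedFactorial (x : ℚ) (n : ℕ) : ℚ := (ascPochhammer ℚ n).eval x

/-- The quotient `(x)_n / (x)_k` for `k ≤ n`, that is `(x+k)(x+k+1) ⋯ (x+n-1)`. It is the value at
`x` of the rational function `(X)_n / (X)_k` (a polynomial), so it also makes sense at the points
`x` where both `(x)_n` and `(x)_k` vanish. -/
noncomputable def shiftedFactorialQuot (x : ℚ) (n k : ℕ) : ℚ := shiftedFactorial (x + k) (n - k)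

/-- Wherever `(x)_k ≠ 0`, `shiftedFactorialQuot x n k` is the literal quotient. -/
theorem shiftedFactorialQuot_eq_div {x : ℚ} {n k : ℕ} (hk : k ≤ n)
    (hx : shiftedFactorial x k ≠ 0) :
    shiftedFactorialQuot x n k = shiftedFactorial x n / shiftedFactorial x k := by
  rw [eq_div_iff hx]
  have h := congrArg (Polynomial.eval x) (ascPochhammer_mul ℚ k (n - k))
  rw [Nat.add_sub_cancel' hk] at h
  simp only [Polynomial.eval_mul, Polynomial.eval_comp, Polynomial.eval_add, Polynomial.eval_X,
    Polynomial.eval_natCast] at h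
  rw [shiftedFactorialQuot, shiftedFactorial, shiftedFactorial, shiftedFactorial, ← h, mul_comm]

/-- For a prime `p`: the congruence `a ≡ b (mod p ^ e)` of rational numbers, that is
`a - b ∈ p ^ e ℤ_(p)`: the difference is `p ^ e` times a fraction with denominator prime to `p`. -/
def RatCongr (p e : ℕ) (a b : ℚ) : Prop :=
  ∃ u v : ℤ, ¬ (p : ℤ) ∣ v ∧ a - b = (p : ℚ) ^ e * ((u : ℚ) / (v : ℚ))

/-! Put a = r/d and t = p^s/d, so that a + N = t, and let u_k = (a)_k/k! and R_k = (a+t)_k (a-t)_k /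
((1+t)_k (1-t)_k). The quotient R deforms u² and vanishes for k > N because a - t = -N. Under the
weight 2k + a one splits u⁶ = u² (u² - R)² + u² R (2u² - R).

First part: by Pfaff–Saalschütz (`sqDiffProd_div_eq_sum`), u² and R are combinations of the
polynomials `wellPoised a i`. Their coefficients are p-integral and agree modulo p², since p²
divides t²/j² for 0 < j < p^s. The ℤ_(p)-span of these polynomials is closed under products
(`mul_mem_wellPoisedSpan`), and the weighted sum of any of its elements is divisible by p^s
(`sum_mem_wellPoisedSpan`). The squared difference thus contributes only a multiple of p^(s+4).

Second part: only 2u² - R is expanded. Each basis polynomial summed against u² R has a closed form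
carrying the factor t (`sum_termWeight_wellPoised`). Expanding the resulting products of 1 - t²/j²
and 1 - t²/(a+j)² to first order modulo p⁴ gives the right-hand side (`sum_terms_congr`). -/

/-! ### Shifted factorials. -/

theorem shiftedFactorial_zero (x : ℚ) : shiftedFactorial x 0 = 1 := by
  simp [shiftedFactorial]

theorem shiftedFactorial_succ (x : ℚ) (n : ℕ) :
    shiftedFactorial x (n + 1) = shiftedFactorial x n * (x + n) := by
  simp [shiftedFactorial, ascPochhammer_succ_eval]

theorem shiftedFactorial_eq_prod (x : ℚ) (n : ℕ) :
    shiftedFactorial x n = ∏ j ∈ Finset.range n, (x + j) := by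
  induction n with
  | zero => simp [shiftedFactorial_zero]
  | succ n ih => rw [shiftedFactorial_succ, ih, Finset.prod_range_succ]

theorem shiftedFactorial_add (x : ℚ) (m n : ℕ) :
    shiftedFactorial x (m + n) = shiftedFactorial x m * shiftedFactorial (x + m) n := by
  simp only [shiftedFactorial_eq_prod, Finset.prod_range_add]
  congr 1
  refine Finset.prod_congr rfl fun j _ => ?_
  push_cast
  ring

theorem shiftedFactorial_succ_left (x : ℚ) (n : ℕ) :
    shiftedFactorial x (n + 1) = x * shiftedFactorial (x + 1) n := by
  rw [add_comm n 1, shiftedFactorial_add]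
  simp [shiftedFactorial_eq_prod]

theorem shiftedFactorial_one (n : ℕ) : shiftedFactorial 1 n = (n.factorial : ℚ) := by
  induction n with
  | zero => simp [shiftedFactorial_zero]
  | succ n ih => rw [shiftedFactorial_succ, ih, Nat.factorial_succ]; push_cast; ring

/-- `(-n)_i` vanishes for `i > n`. -/
theorem shiftedFactorial_neg_natCast_eq_zero {n i : ℕ} (h : n < i) :
    shiftedFactorial (-(n : ℚ)) i = 0 := by
  rw [shiftedFactorial_eq_prod]
  exact Finset.prod_eq_zero (Finset.mem_range.2 h) (by simp)

theorem shiftedFactorial_neg (x : ℚ) (n : ℕ) :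
    shiftedFactorial (-x) n = (-1) ^ n * shiftedFactorial (x - n + 1) n := by
  induction n generalizing x with
  | zero => simp [shiftedFactorial_zero]
  | succ n ih =>
    rw [shiftedFactorial_succ_left, shiftedFactorial_succ, show -x + 1 = -(x - 1) by ring, ih,
      show x - 1 - (n : ℚ) + 1 = x - ((n + 1 : ℕ) : ℚ) + 1 by push_cast; ring]
    push_cast
    ring

theorem shiftedFactorial_neg_natCast {n i : ℕ} (h : i ≤ n) :
    shiftedFactorial (-(n : ℚ)) i * ((n - i).factorial : ℚ) = (-1) ^ i * (n.factorial : ℚ) := by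
  rw [shiftedFactorial_neg, ← shiftedFactorial_one n, ← shiftedFactorial_one (n - i)]
  have := shiftedFactorial_add 1 (n - i) i
  rw [Nat.sub_add_cancel h, Nat.cast_sub h, show (1 : ℚ) + (n - i) = n - i + 1 by ring] at this
  rw [this]
  ring

/-- `∏_{j < k} ((x + j)² - y)`, which is `(x + √y)_k (x - √y)_k`. -/
def sqDiffProd (x y : ℚ) (k : ℕ) : ℚ := ∏ j ∈ Finset.range k, ((x + j) ^ 2 - y)

theorem sqDiffProd_succ (x y : ℚ) (k : ℕ) :
    sqDiffProd x y (k + 1) = sqDiffProd x y k * ((x + k) ^ 2 - y) :=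
  Finset.prod_range_succ _ _

theorem sqDiffProd_zero (x y : ℚ) : sqDiffProd x y 0 = 1 := rfl

theorem sqDiffProd_zero_right (x : ℚ) (k : ℕ) :
    sqDiffProd x 0 k = shiftedFactorial x k ^ 2 := by
  simp [sqDiffProd, shiftedFactorial_eq_prod, Finset.prod_pow]

theorem sqDiffProd_sq (x t : ℚ) (k : ℕ) :
    sqDiffProd x (t ^ 2) k = shiftedFactorial (x + t) k * shiftedFactorial (x - t) k := by
  rw [sqDiffProd, shiftedFactorial_eq_prod, shiftedFactorial_eq_prod, ← Finset.prod_mul_distrib]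
  exact Finset.prod_congr rfl fun j _ => by ring

/-! ### The well-poised basis: expansion, summation, multiplication. -/

/-- The polynomials `(-k)_i (a + k)_i / i!²` in `k (k + a)`: the basis in which
very-well-poised sums are expanded. -/
noncomputable def wellPoised (a : ℚ) (i k : ℕ) : ℚ :=
  shiftedFactorial (-(k : ℚ)) i * shiftedFactorial (a + k) i / (i.factorial : ℚ) ^ 2

theorem wellPoised_eq_zero (a : ℚ) {i k : ℕ} (h : k < i) : wellPoised a i k = 0 := by
  simp [wellPoised, shiftedFactorial_neg_natCast_eq_zero h]

theorem wellPoised_succ (a : ℚ) (i k : ℕ) :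
    (i + 1 : ℚ) ^ 2 * wellPoised a (i + 1) k = wellPoised a i k * ((i - k) * (a + k + i)) := by
  have h : (i.factorial : ℚ) ≠ 0 := by positivity
  have h' : (i + 1 : ℚ) ≠ 0 := by positivity
  simp only [wellPoised, shiftedFactorial_succ, Nat.factorial_succ]
  push_cast
  field_simp
  ring

/-- Coefficients of the expansion of `(a + √y)_k (a - √y)_k / ((1 + √y)_k (1 - √y)_k)`. -/
noncomputable def saalCoeff (a y : ℚ) (i : ℕ) : ℚ :=
  shiftedFactorial (1 - a) i * (i.factorial : ℚ) / sqDiffProd 1 y i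

theorem saalCoeff_succ {a y : ℚ} {i : ℕ} (h : (1 + i : ℚ) ^ 2 - y ≠ 0) :
    saalCoeff a y (i + 1) * ((1 + i : ℚ) ^ 2 - y) = saalCoeff a y i * ((1 - a + i) * (i + 1)) := by
  rw [saalCoeff, saalCoeff, sqDiffProd_succ, shiftedFactorial_succ, Nat.factorial_succ]
  push_cast
  rw [← div_div, div_mul_cancel₀ _ h]
  ring

/-- Telescoping certificate for the Pfaff–Saalschütz expansion. -/
theorem saal_certificate {a y : ℚ} (k n : ℕ) (hy : ∀ j < n, (1 + j : ℚ) ^ 2 - y ≠ 0) :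
    ∑ i ∈ Finset.range (n + 1), (((1 + k : ℚ) ^ 2 - y) * (wellPoised a i (k + 1) * saalCoeff a y i) -
      ((a + k) ^ 2 - y) * (wellPoised a i k * saalCoeff a y i)) =
    (2 * k + 1 + a) * (shiftedFactorial (-(k : ℚ)) n * shiftedFactorial (a + k + 1) n /
      (n.factorial : ℚ) ^ 2 * (saalCoeff a y n * (1 - a + n))) := by
  induction n with
  | zero =>
    simp [wellPoised, saalCoeff, shiftedFactorial_zero, sqDiffProd_zero]
    ring
  | succ n ih =>
    rw [Finset.sum_range_succ, ih fun j hj => hy j (by omega)]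
    have hn := hy n (by omega)
    have h := saalCoeff_succ (a := a) hn
    have hf : (n.factorial : ℚ) ≠ 0 := by positivity
    have h' : (n + 1 : ℚ) ≠ 0 := by positivity
    have e1 : saalCoeff a y n * (1 - a + n) =
        saalCoeff a y (n + 1) * ((1 + n : ℚ) ^ 2 - y) / (n + 1) := by
      rw [h]; field_simp
    rw [e1]
    have e2 : shiftedFactorial (-((k + 1 : ℕ) : ℚ)) (n + 1) =
        -(k + 1) * shiftedFactorial (-(k : ℚ)) n := by
      rw [shiftedFactorial_succ_left]
      push_cast
      congr 2
      all_goals ring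
    have e3 : shiftedFactorial (a + k) (n + 1) = (a + k) * shiftedFactorial (a + k + 1) n :=
      shiftedFactorial_succ_left _ _
    rw [wellPoised, wellPoised, e2, e3, show a + ((k + 1 : ℕ) : ℚ) = a + k + 1 by push_cast; ring]
    simp only [shiftedFactorial_succ, Nat.factorial_succ]
    push_cast
    field_simp
    ring

/-- A case of the Pfaff–Saalschütz theorem. -/
theorem sqDiffProd_div_eq_sum (a y : ℚ) {k n : ℕ} (hkn : k < n)
    (hy : ∀ j, j + 1 < n → (1 + j : ℚ) ^ 2 - y ≠ 0) :
    sqDiffProd a y k / sqDiffProd 1 y k =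
      ∑ i ∈ Finset.range n, wellPoised a i k * saalCoeff a y i := by
  induction k with
  | zero =>
    rw [Finset.sum_eq_single_of_mem 0 (by simpa using hkn)
      fun i _ hi => by rw [wellPoised_eq_zero a (by omega), zero_mul]]
    simp [wellPoised, saalCoeff, shiftedFactorial_zero, sqDiffProd_zero]
  | succ k ih =>
    have hk := hy k (by omega)
    obtain ⟨n, rfl⟩ : ∃ l, n = l + 1 := ⟨n - 1, by omega⟩
    -- The remainder of the certificate contains (-k)_n with k < n, so it vanishes. What is left is
    -- the first-order recurrence in k satisfied by the quotient.
    have h := saal_certificate (a := a) k n fun j hj => hy j (by omega)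
    rw [Finset.sum_sub_distrib, ← Finset.mul_sum, ← Finset.mul_sum, ← ih (by omega),
      shiftedFactorial_neg_natCast_eq_zero (by omega : k < n)] at h
    rw [sqDiffProd_succ, sqDiffProd_succ, mul_div_mul_comm, mul_div_assoc', div_eq_iff hk]
    linear_combination -h

/-- The very-well-poised weight makes every basis function summable in closed form. -/
theorem sum_wellPoised (a : ℚ) (i n : ℕ) :
    ∑ k ∈ Finset.range n, (2 * k + a) * wellPoised a i k =
      -(shiftedFactorial (-(n : ℚ)) (i + 1) * shiftedFactorial (a + n - 1) (i + 1) /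
        ((i.factorial : ℚ) * ((i + 1).factorial : ℚ))) := by
  induction n with
  | zero => simp [shiftedFactorial_succ_left]
  | succ n ih =>
    rw [Finset.sum_range_succ, ih, wellPoised]
    have hf : (i.factorial : ℚ) ≠ 0 := by positivity
    have h' : (i + 1 : ℚ) ≠ 0 := by positivity
    have e1 : shiftedFactorial (-((n + 1 : ℕ) : ℚ)) (i + 1) =
        -(n + 1) * shiftedFactorial (-(n : ℚ)) i := by
      rw [shiftedFactorial_succ_left]
      push_cast
      congr 2
      all_goals ring
    have e2 : shiftedFactorial (a + n - 1) (i + 1) =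
        (a + n - 1) * shiftedFactorial (a + n) i := by
      rw [shiftedFactorial_succ_left]
      congr 2; ring
    have e3 : a + ((n + 1 : ℕ) : ℚ) - 1 = a + n := by push_cast; ring
    rw [e1, e2, e3]
    simp only [shiftedFactorial_succ, Nat.factorial_succ]
    push_cast
    field_simp
    ring

/-- Induction on j, splitting the new factor (j-k)(a+k+j) as (x+h-k)(a+k+x+h) + (j-x-h)(a+x+j+h).
For x = i, the products (i-k)_h (a+k+i)_h are what raises the basis index from i to i + h. -/
theorem shiftedFactorial_mul_eq_sum (a k x : ℚ) (j : ℕ) :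
    shiftedFactorial (-k) j * shiftedFactorial (a + k) j =
      ∑ h ∈ Finset.range (j + 1), (j.choose h : ℚ) * shiftedFactorial (-x) (j - h) *
        shiftedFactorial (x + a + h) (j - h) *
        (shiftedFactorial (x - k) h * shiftedFactorial (a + k + x) h) := by
  induction j with
  | zero => simp [shiftedFactorial_zero]
  | succ j ih =>
    rw [shiftedFactorial_succ, shiftedFactorial_succ]
    have : shiftedFactorial (-k) j * (-k + j) * (shiftedFactorial (a + k) j * (a + k + j)) =
        (shiftedFactorial (-k) j * shiftedFactorial (a + k) j) * ((j - k) * (a + k + j)) := by ring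
    rw [this, ih, Finset.sum_mul]
    let u : ℕ → ℚ := fun h => shiftedFactorial (x - k) h * shiftedFactorial (a + k + x) h
    have hu : ∀ h : ℕ, u (h + 1) = u h * ((x + h - k) * (a + k + x + h)) := fun h => by
      simp only [u, shiftedFactorial_succ]; ring
    let e : ℕ → ℚ := fun h => (j.choose h : ℚ) * shiftedFactorial (-x) (j - h) *
        shiftedFactorial (x + a + h) (j - h)
    have hterm : ∀ h ∈ Finset.range (j + 1),
        (j.choose h : ℚ) * shiftedFactorial (-x) (j - h) * shiftedFactorial (x + a + h) (j - h) *
        (shiftedFactorial (x - k) h * shiftedFactorial (a + k + x) h) *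
          ((j - k) * (a + k + j)) =
        e h * u (h + 1) + e h * ((j - x - h) * (a + x + j + h)) * u h := by
      intro h _
      rw [hu]; simp only [e, u]; ring
    rw [Finset.sum_congr rfl hterm, Finset.sum_add_distrib, Finset.sum_range_succ'
        (fun h => e h * ((j - x - h) * (a + x + j + h)) * u h),
      Finset.sum_range_succ (fun h => e h * u (h + 1)), Finset.sum_range_succ' (n := j + 1),
      Finset.sum_range_succ _ j]
    have hmid : ∀ h ∈ Finset.range j, ((j + 1).choose (h + 1) : ℚ) *
        shiftedFactorial (-x) (j + 1 - (h + 1)) *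
        shiftedFactorial (x + a + ((h + 1 : ℕ) : ℚ)) (j + 1 - (h + 1)) *
        (shiftedFactorial (x - k) (h + 1) * shiftedFactorial (a + k + x) (h + 1)) =
        e h * u (h + 1) + e (h + 1) * ((j - x - ((h + 1 : ℕ) : ℚ)) *
          (a + x + j + ((h + 1 : ℕ) : ℚ))) * u (h + 1) := by
      intro h hh
      obtain ⟨l, rfl⟩ : ∃ l, j = h + 1 + l :=
        ⟨j - (h + 1), by have := Finset.mem_range.1 hh; omega⟩
      have c : ((h + 1 + l).choose h : ℚ) * (l + 1) = (h + 1 + l).choose (h + 1) * (h + 1) := by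
        have := Nat.choose_succ_right_eq (h + 1 + l) h
        rw [show h + 1 + l - h = l + 1 by omega] at this
        exact_mod_cast this.symm
      have c' : ((h + 1 + l).choose h : ℚ) = (h + 1 + l).choose (h + 1) * (h + 1) / (l + 1) := by
        rw [← c]; field_simp
      simp only [e, u, show h + 1 + l + 1 - (h + 1) = l + 1 by omega,
        show h + 1 + l - h = l + 1 by omega, show h + 1 + l - (h + 1) = l by omega]
      rw [Nat.choose_succ_succ, Nat.cast_add, c', shiftedFactorial_succ_left (x + a + h) l,
        shiftedFactorial_succ (-x), shiftedFactorial_succ (x + a + _),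
        show x + a + (h : ℚ) + 1 = x + a + ((h + 1 : ℕ) : ℚ) by push_cast; ring]
      generalize shiftedFactorial (x - k) (h + 1) * shiftedFactorial (a + k + x) (h + 1) = U
      generalize shiftedFactorial (x + a + ((h + 1 : ℕ) : ℚ)) l = V
      push_cast
      field_simp
      ring
    rw [Finset.sum_congr rfl hmid, Finset.sum_add_distrib]
    simp only [e, Nat.choose_zero_right, Nat.choose_self, Nat.sub_zero, Nat.sub_self]
    simp only [u, shiftedFactorial_zero, shiftedFactorial_succ]
    push_cast
    ring

/-- The basis functions multiply into one another. -/
theorem wellPoised_mul (a : ℚ) (i j k : ℕ) :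
    wellPoised a i k * wellPoised a j k =
      ∑ h ∈ Finset.range (j + 1), ((i + h).factorial : ℚ) ^ 2 / ((i.factorial : ℚ) ^ 2 *
        (j.factorial : ℚ) ^ 2) * ((j.choose h : ℚ) * shiftedFactorial (-(i : ℚ)) (j - h) *
        shiftedFactorial (i + a + h) (j - h)) * wellPoised a (i + h) k := by
  have : wellPoised a j k = (shiftedFactorial (-(k : ℚ)) j * shiftedFactorial (a + k) j) /
    (j.factorial : ℚ) ^ 2 := rfl
  rw [this, shiftedFactorial_mul_eq_sum a k i j, Finset.sum_div, Finset.mul_sum]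
  refine Finset.sum_congr rfl fun h _ => ?_
  have h1 : ((i + h).factorial : ℚ) ≠ 0 := by positivity
  rw [wellPoised, wellPoised, shiftedFactorial_add, shiftedFactorial_add,
    show -(k : ℚ) + i = i - k by ring]
  field_simp

theorem wellPoised_succ_right (a : ℚ) (i k : ℕ) :
    wellPoised a i (k + 1) * ((k + 1 - i) * (a + k)) =
      wellPoised a i k * ((k + 1) * (a + k + i)) := by
  have e1 := shiftedFactorial_succ (-((k + 1 : ℕ) : ℚ)) i
  rw [shiftedFactorial_succ_left, show -((k + 1 : ℕ) : ℚ) + 1 = -(k : ℚ) by push_cast; ring] at e1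
  have e2 := shiftedFactorial_succ (a + k) i
  rw [shiftedFactorial_succ_left, show a + (k : ℚ) + 1 = a + ((k + 1 : ℕ) : ℚ) by
    push_cast; ring] at e2
  have hf : (i.factorial : ℚ) ≠ 0 := by positivity
  rw [wellPoised, wellPoised]
  push_cast at e1 e2 ⊢
  field_simp
  linear_combination -(shiftedFactorial (a + (k + 1)) i * (a + k)) * -e1 +
    (k + 1) * shiftedFactorial (-(k : ℚ)) i * e2

/-! ### Sums of the basis against the weight u² R. -/

/-- The weight `(a)_k² (a + t)_k (a - t)_k / (k!² (1 + t)_k (1 - t)_k)`, with `y = t²`. -/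
noncomputable def termWeight (a y : ℚ) (k : ℕ) : ℚ :=
  (shiftedFactorial a k / (k.factorial : ℚ)) ^ 2 * (sqDiffProd a y k / sqDiffProd 1 y k)

theorem termWeight_succ {a y : ℚ} {k : ℕ} (h : (1 + k : ℚ) ^ 2 - y ≠ 0) :
    termWeight a y (k + 1) * ((k + 1) ^ 2 * ((1 + k : ℚ) ^ 2 - y)) =
      termWeight a y k * ((a + k) ^ 2 * ((a + k) ^ 2 - y)) := by
  have hf : (k.factorial : ℚ) ≠ 0 := by positivity
  have h' : (k + 1 : ℚ) ≠ 0 := by positivity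
  simp only [termWeight, shiftedFactorial_succ, sqDiffProd_succ, Nat.factorial_succ]
  rw [mul_div_mul_comm (sqDiffProd a y k)]
  push_cast
  field_simp

/-- Creative telescoping: `wellPoised_succ` turns the factor (i-k)(a+k+i) into a shift of i, so once
the boundary is accounted for this is a two-term recurrence in i for the weighted sums. -/
theorem sum_termWeight_certificate {a y : ℚ} (i n : ℕ) (ha : ∀ j < n, a + j ≠ 0)
    (hy : ∀ j < n, (1 + j : ℚ) ^ 2 - y ≠ 0) :
    ∑ k ∈ Finset.range n, (2 * k + a) * termWeight a y k * (wellPoised a i k *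
      ((2 * a + i) * ((i - k) * (a + k + i)) - (a + i) * ((a + i) ^ 2 - y))) =
    -(termWeight a y n * wellPoised a i n * (n * ((n : ℚ) ^ 2 - y) * (n - i))) := by
  induction n with
  | zero => simp
  | succ n ih =>
    rw [Finset.sum_range_succ, ih (fun j hj => ha j (by omega)) fun j hj => hy j (by omega)]
    have h1 := termWeight_succ (a := a) (hy n (by omega))
    have h2 := wellPoised_succ_right a i n
    have h3 := ha n (by omega)
    have h4 : (n + 1 : ℚ) ≠ 0 := by positivity
    have h5 : termWeight a y (n + 1) * wellPoised a i (n + 1) *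
        ((n + 1) * ((1 + n : ℚ) ^ 2 - y) * (n + 1 - i)) =
        termWeight a y n * wellPoised a i n * ((a + n) * ((a + n) ^ 2 - y) * (a + n + i)) := by
      apply mul_right_cancel₀ (mul_ne_zero h4 h3)
      linear_combination wellPoised a i (n + 1) * ((n + 1 - i) * (a + n)) * h1 +
        termWeight a y n * ((a + n) ^ 2 * ((a + n) ^ 2 - y)) * h2
    push_cast
    linear_combination h5

/-- The induction runs downward from i = N, where only the term k = N survives. Descending divides
by (a+i)((a+i)² - t²), nonzero for i < N; ascending would divide by 2a + i, which may vanish. -/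
theorem sum_termWeight_wellPoised {a t : ℚ} {N : ℕ} (hN : a + N = t)
    (ha : ∀ j ≤ N, a + j ≠ 0) (hat : ∀ j < N, a + t + j ≠ 0)
    (ht : ∀ j < N, (1 + j : ℚ) ^ 2 - t ^ 2 ≠ 0) {i : ℕ} (hi : i ≤ N) :
    ∑ k ∈ Finset.range (N + 1), (2 * k + a) * termWeight a (t ^ 2) k * wellPoised a i k =
      t / (N.factorial : ℚ) * (shiftedFactorial (2 * a + i) (N - i) * (shiftedFactorial a i *
        sqDiffProd a (t ^ 2) i / (i.factorial : ℚ) ^ 2)) := by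
  induction hi using Nat.decreasingInduction with
  | self =>
    rw [Finset.sum_range_succ, Finset.sum_eq_zero, zero_add]
    swap
    · intro k hk
      rw [wellPoised_eq_zero a (Finset.mem_range.1 hk), mul_zero]
    have hf : (N.factorial : ℚ) ≠ 0 := by positivity
    have hden : sqDiffProd 1 (t ^ 2) N ≠ 0 :=
      Finset.prod_ne_zero_iff.2 fun j hj => ht j (Finset.mem_range.1 hj)
    have e1 := shiftedFactorial_neg_natCast (le_refl N)
    rw [Nat.sub_self, Nat.factorial_zero, Nat.cast_one, mul_one] at e1
    have e2 : shiftedFactorial a N = (-1) ^ N * shiftedFactorial (1 - t) N := by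
      rw [show a = -(-a) by ring, shiftedFactorial_neg]
      congr 2
      rw [← hN]; ring
    have e3 : (t + N) * shiftedFactorial t N = t * shiftedFactorial (1 + t) N := by
      rw [mul_comm, ← shiftedFactorial_succ, shiftedFactorial_succ_left, add_comm t 1]
    have e4 : ((-1 : ℚ) ^ N) * (-1) ^ N = 1 := by rw [← mul_pow]; norm_num
    rw [Nat.sub_self, shiftedFactorial_zero, termWeight, wellPoised, e1, hN,
      show 2 * (N : ℚ) + a = t + N by rw [← hN]; ring]
    rw [sqDiffProd_sq 1] at hden ⊢
    rw [e2]
    generalize shiftedFactorial (1 - t) N = x₁ at *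
    generalize shiftedFactorial (1 + t) N = x₂ at *
    generalize shiftedFactorial t N = x₃ at *
    generalize sqDiffProd a (t ^ 2) N = S
    generalize (-1 : ℚ) ^ N = σ at *
    obtain ⟨h₂, h₁⟩ := mul_ne_zero_iff.1 hden
    calc _ = (t + N) * x₃ * (σ * σ * σ * x₁ * S / ((N.factorial : ℚ) ^ 3 * x₂)) := by
          field_simp
      _ = _ := by
          rw [e3, e4]
          field_simp
  | of_succ i hi ih =>
    have hi' : (i + 1 : ℚ) ≠ 0 := by positivity
    have hf : (i.factorial : ℚ) ≠ 0 := by positivity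
    have h1 : (a + i) * ((a + i) ^ 2 - t ^ 2) ≠ 0 := by
      refine mul_ne_zero (ha i hi.le) ?_
      rw [show (a + i) ^ 2 - t ^ 2 = (a + t + i) * (i - N) by rw [← hN]; ring]
      refine mul_ne_zero (hat i hi) (sub_ne_zero.2 ?_)
      exact_mod_cast hi.ne
    have hcert : ∑ k ∈ Finset.range (N + 1), (2 * k + a) * termWeight a (t ^ 2) k *
        (wellPoised a i k * ((2 * a + i) * ((i - k) * (a + k + i)) -
          (a + i) * ((a + i) ^ 2 - t ^ 2))) = 0 := by
      -- The term k = N is split off because the certificate up to N + 1 would need (1+N)² ≠ t²,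
      -- which fails for a = 1. It cancels the boundary term since t = a + N.
      rw [Finset.sum_range_succ, sum_termWeight_certificate i N (fun j hj => ha j hj.le) ht,
        ← hN]
      ring
    have hsplit : (2 * a + i) * (i + 1) ^ 2 * ∑ k ∈ Finset.range (N + 1),
          (2 * k + a) * termWeight a (t ^ 2) k * wellPoised a (i + 1) k =
        (a + i) * ((a + i) ^ 2 - t ^ 2) * ∑ k ∈ Finset.range (N + 1),
          (2 * k + a) * termWeight a (t ^ 2) k * wellPoised a i k := by
      rw [← sub_eq_zero, ← hcert, Finset.mul_sum, Finset.mul_sum, ← Finset.sum_sub_distrib]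
      refine Finset.sum_congr rfl fun k _ => ?_
      linear_combination (2 * a + i) * (2 * k + a) * termWeight a (t ^ 2) k * wellPoised_succ a i k
    apply mul_left_cancel₀ h1
    rw [← hsplit, ih]
    obtain ⟨l, rfl⟩ : ∃ l, N = i + 1 + l := ⟨N - (i + 1), by omega⟩
    rw [show i + 1 + l - (i + 1) = l by omega, show i + 1 + l - i = l + 1 by omega,
      shiftedFactorial_succ_left (2 * a + i), shiftedFactorial_succ a, sqDiffProd_succ,
      Nat.factorial_succ, show 2 * a + ((i + 1 : ℕ) : ℚ) = 2 * a + i + 1 by push_cast; ring]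
    have hf' : ((i + 1 + l).factorial : ℚ) ≠ 0 := by positivity
    push_cast
    field_simp

/-! ### Arithmetic in ℤ_(p). -/

/-- The ring `ℤ_(p)` of rational numbers with denominator prime to `p`. -/
def integralAt (p : ℕ) (hp : p.Prime) : Subring ℚ where
  carrier := {x | ∃ u v : ℤ, ¬ (p : ℤ) ∣ v ∧ x = (u : ℚ) / v}
  zero_mem' := ⟨0, 1, fun h => (Nat.prime_iff_prime_int.1 hp).not_dvd_one h, by simp⟩
  one_mem' := ⟨1, 1, fun h => (Nat.prime_iff_prime_int.1 hp).not_dvd_one h, by simp⟩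
  neg_mem' := by
    rintro _ ⟨u, v, hv, rfl⟩
    exact ⟨-u, v, hv, by push_cast; ring⟩
  add_mem' := by
    rintro _ _ ⟨u, v, hv, rfl⟩ ⟨u', v', hv', rfl⟩
    have h0 : (v : ℚ) ≠ 0 := by rintro h; apply hv; simp [Int.cast_eq_zero.1 h]
    have h0' : (v' : ℚ) ≠ 0 := by rintro h; apply hv'; simp [Int.cast_eq_zero.1 h]
    refine ⟨u * v' + u' * v, v * v',
      fun h => ((Nat.prime_iff_prime_int.1 hp).dvd_or_dvd h).elim hv hv', ?_⟩
    push_cast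
    field_simp
  mul_mem' := by
    rintro _ _ ⟨u, v, hv, rfl⟩ ⟨u', v', hv', rfl⟩
    refine ⟨u * u', v * v',
      fun h => ((Nat.prime_iff_prime_int.1 hp).dvd_or_dvd h).elim hv hv', ?_⟩
    push_cast
    rw [mul_div_mul_comm]

section integralAt

variable {p : ℕ} {hp : p.Prime}

theorem div_intCast_mem_integralAt (u : ℤ) {v : ℤ} (hv : ¬ (p : ℤ) ∣ v) :
    (u : ℚ) / v ∈ integralAt p hp := ⟨u, v, hv, rfl⟩

theorem ratCongr_iff {e : ℕ} {a b : ℚ} :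
    RatCongr p e a b ↔ ∃ x ∈ integralAt p hp, a - b = (p : ℚ) ^ e * x := by
  constructor
  · rintro ⟨u, v, hv, h⟩
    exact ⟨_, ⟨u, v, hv, rfl⟩, h⟩
  · rintro ⟨_, ⟨u, v, hv, rfl⟩, h⟩
    exact ⟨u, v, hv, h⟩

theorem one_sub_mul_inv_mem_integralAt {x : ℚ} (hx : x ∈ integralAt p hp) :
    1 - p * x ≠ 0 ∧ (1 - p * x)⁻¹ ∈ integralAt p hp := by
  obtain ⟨u, v, hv, rfl⟩ := hx
  have h0 : (v : ℚ) ≠ 0 := by rintro h; apply hv; simp [Int.cast_eq_zero.1 h]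
  have hd : ¬ (p : ℤ) ∣ v - p * u := fun h => hv ((dvd_sub_left (dvd_mul_right _ _)).1 h)
  have h1 : (v - p * u : ℚ) ≠ 0 := by
    intro h
    apply hd
    rw [show v - p * u = 0 by exact_mod_cast h]
    exact dvd_zero _
  have h2 : 1 - (p : ℚ) * (u / v) = (v - p * u) / v := by field_simp
  rw [h2]
  refine ⟨div_ne_zero h1 h0, v, v - p * u, hd, ?_⟩
  push_cast
  rw [inv_div]

/-- The p-adic valuation of z is below s, so at least one factor p survives. -/
theorem pow_div_intCast_mem_integralAt {s : ℕ} {z : ℤ} (hz : ¬ (p : ℤ) ^ s ∣ z) :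
    ∃ x ∈ integralAt p hp, (p : ℚ) ^ s / z = p * x := by
  have hpi := Nat.prime_iff_prime_int.1 hp
  have hz0 : z ≠ 0 := by rintro rfl; exact hz (dvd_zero _)
  have hfin : FiniteMultiplicity (p : ℤ) z :=
    Int.finiteMultiplicity_iff.2 ⟨by simpa using hp.ne_one, hz0⟩
  obtain ⟨q, hq, hpq⟩ := hfin.exists_eq_pow_mul_and_not_dvd
  set e := multiplicity (p : ℤ) z
  have he : e < s := by
    by_contra! h
    exact hz (hq ▸ (pow_dvd_pow _ h).mul_right q)
  obtain ⟨l, rfl⟩ : ∃ l, s = e + 1 + l := ⟨s - (e + 1), by omega⟩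
  refine ⟨(((p : ℤ) ^ l : ℤ) : ℚ) / q, div_intCast_mem_integralAt _ hpq, ?_⟩
  have hp0 : (p : ℚ) ≠ 0 := by exact_mod_cast hp.ne_zero
  have hq0 : (q : ℚ) ≠ 0 := by rintro h; apply hpq; simp [Int.cast_eq_zero.1 h]
  rw [hq]
  push_cast
  field_simp
  ring

theorem shiftedFactorial_sub_mem_integralAt {x y c : ℚ} (hx : x ∈ integralAt p hp)
    (hy : y ∈ integralAt p hp) (h : ∃ w ∈ integralAt p hp, x - y = c * w) (n : ℕ) :
    shiftedFactorial x n ∈ integralAt p hp ∧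
      ∃ w ∈ integralAt p hp, shiftedFactorial x n - shiftedFactorial y n = c * w := by
  have hmem : ∀ z ∈ integralAt p hp, ∀ n, shiftedFactorial z n ∈ integralAt p hp := by
    intro z hz n
    rw [shiftedFactorial_eq_prod]
    exact prod_mem fun j _ => add_mem hz (natCast_mem _ j)
  refine ⟨hmem x hx n, ?_⟩
  obtain ⟨w, hw, hxy⟩ := h
  induction n with
  | zero => exact ⟨0, zero_mem _, by simp [shiftedFactorial_zero]⟩
  | succ n ih =>
    obtain ⟨w', hw', h'⟩ := ih
    refine ⟨w' * (x + n) + shiftedFactorial y n * w, add_mem (mul_mem hw' (add_mem hx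
      (natCast_mem _ n))) (mul_mem (hmem y hy n) hw), ?_⟩
    rw [shiftedFactorial_succ, shiftedFactorial_succ]
    linear_combination (x + n) * h' + shiftedFactorial y n * hxy

theorem exists_natCast_sub_mem_integralAt {x : ℚ} (hx : x ∈ integralAt p hp) (e : ℕ) :
    ∃ a : ℕ, ∃ w ∈ integralAt p hp, x - a = (p : ℚ) ^ e * w := by
  obtain ⟨u, v, hv, rfl⟩ := hx
  have h0 : (v : ℚ) ≠ 0 := by rintro h; apply hv; simp [Int.cast_eq_zero.1 h]
  have hpi := Nat.prime_iff_prime_int.1 hp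
  obtain ⟨b, c, hbc⟩ : IsCoprime v ((p : ℤ) ^ e) :=
    ((hpi.coprime_iff_not_dvd.2 hv).symm).pow_right
  have hpe : (p : ℤ) ^ e ≠ 0 := pow_ne_zero _ hpi.ne_zero
  have hnn := Int.emod_nonneg (u * b) hpe
  refine ⟨(u * b % (p : ℤ) ^ e).toNat, u * c / v + (u * b / (p : ℤ) ^ e : ℤ),
    add_mem ⟨u * c, v, hv, by push_cast; rfl⟩ (intCast_mem _ _), ?_⟩
  have h1 : (((u * b % (p : ℤ) ^ e).toNat : ℕ) : ℚ) = ((u * b % (p : ℤ) ^ e : ℤ) : ℚ) := by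
    exact_mod_cast congrArg (Int.cast : ℤ → ℚ) (Int.toNat_of_nonneg hnn)
  have h2 : ((u * b % (p : ℤ) ^ e : ℤ) : ℚ) + (p : ℚ) ^ e * ((u * b / (p : ℤ) ^ e : ℤ) : ℚ) =
      u * b := by
    exact_mod_cast Int.emod_add_mul_ediv (u * b) ((p : ℤ) ^ e)
  have h3 : (b : ℚ) * v + c * (p : ℚ) ^ e = 1 := by exact_mod_cast hbc
  rw [h1, show ((u * b % (p : ℤ) ^ e : ℤ) : ℚ) = u * b - (p : ℚ) ^ e *
    ((u * b / (p : ℤ) ^ e : ℤ) : ℚ) by rw [← h2]; ring]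
  generalize ((u * b / (p : ℤ) ^ e : ℤ) : ℚ) = m
  field_simp
  linear_combination -(u : ℚ) * h3

/-- Let p^e be the exact power of p in n!. Replacing x by a natural number congruent to it modulo
p^e changes (x)_n by a multiple of p^e, and for natural numbers n! divides the product. -/
theorem shiftedFactorial_div_factorial_mem_integralAt {x : ℚ} (hx : x ∈ integralAt p hp) (n : ℕ) :
    shiftedFactorial x n / (n.factorial : ℚ) ∈ integralAt p hp := by
  obtain ⟨e, q, hq, hfac⟩ :=
    Nat.exists_eq_pow_mul_and_not_dvd n.factorial_ne_zero p hp.ne_one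
  obtain ⟨a, ha⟩ := exists_natCast_sub_mem_integralAt hx e
  obtain ⟨w, hw, h⟩ := (shiftedFactorial_sub_mem_integralAt hx (natCast_mem _ a) ha n).2
  obtain ⟨c, hc⟩ := Nat.factorial_dvd_ascFactorial a n
  have hsf : shiftedFactorial a n = ((n.factorial * c : ℕ) : ℚ) := by
    rw [← hc, ← ascPochhammer_nat_eq_ascFactorial, shiftedFactorial, ascPochhammer_eval_cast]
  have hp0 : (p : ℚ) ≠ 0 := by exact_mod_cast hp.ne_zero
  have hq0 : (q : ℚ) ≠ 0 := by
    intro h0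
    apply hq
    rw [Nat.cast_eq_zero.1 h0]
    exact dvd_zero _
  have hfac' : (n.factorial : ℚ) = (p : ℚ) ^ e * q := by exact_mod_cast hfac
  have : shiftedFactorial x n / (n.factorial : ℚ) = c + w * ((1 : ℤ) / (q : ℤ)) := by
    rw [eq_add_of_sub_eq h, hsf]
    push_cast
    rw [hfac']
    field_simp
    ring
  rw [this]
  exact add_mem (natCast_mem _ c) (mul_mem hw (div_intCast_mem_integralAt 1
    (by exact_mod_cast hq)))

/-- First-order expansion: a product of two of the f j is already divisible by p⁴. -/
theorem prod_one_sub_integralAt {f : ℕ → ℚ} (n : ℕ)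
    (hf : ∀ j < n, ∃ w ∈ integralAt p hp, f j = (p : ℚ) ^ 2 * w) :
    (∃ w ∈ integralAt p hp, ∑ j ∈ Finset.range n, f j = (p : ℚ) ^ 2 * w) ∧
    (∃ w ∈ integralAt p hp,
      ∏ j ∈ Finset.range n, (1 - f j) = 1 - ∑ j ∈ Finset.range n, f j + (p : ℚ) ^ 4 * w) ∧
    (∃ w ∈ integralAt p hp,
      ∏ j ∈ Finset.range n, (1 - f j)⁻¹ = 1 + ∑ j ∈ Finset.range n, f j + (p : ℚ) ^ 4 * w) := by
  induction n with
  | zero => exact ⟨⟨0, zero_mem _, by simp⟩, ⟨0, zero_mem _, by simp⟩, ⟨0, zero_mem _, by simp⟩⟩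
  | succ n ih =>
    obtain ⟨⟨s, hs, es⟩, ⟨x, hx, ex⟩, ⟨y, hy, ey⟩⟩ := ih fun j hj => hf j (by omega)
    obtain ⟨w, hw, ew⟩ := hf n (by omega)
    have hpm : (p : ℚ) ∈ integralAt p hp := natCast_mem _ p
    obtain ⟨h0, hinv⟩ := one_sub_mul_inv_mem_integralAt (mul_mem hpm hw)
    rw [← mul_assoc, ← sq] at h0 hinv
    simp only [Finset.sum_range_succ, Finset.prod_range_succ, ex, ey, es, ew]
    refine ⟨⟨s + w, add_mem hs hw, by ring⟩,
      ⟨s * w + x * (1 - (p : ℚ) ^ 2 * w), ?_, by ring⟩,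
      ⟨(w * w + s * w + y) * (1 - (p : ℚ) ^ 2 * w)⁻¹,
        mul_mem (add_mem (add_mem (mul_mem hw hw) (mul_mem hs hw)) hy) hinv, ?_⟩⟩
    · exact add_mem (mul_mem hs hw)
        (mul_mem hx (sub_mem (one_mem _) (mul_mem (pow_mem hpm 2) hw)))
    · field_simp
      ring

end integralAt

theorem sqDiffProd_eq_mul_prod {x : ℚ} (y : ℚ) {n : ℕ} (hx : ∀ j < n, x + j ≠ 0) :
    sqDiffProd x y n =
      shiftedFactorial x n ^ 2 * ∏ j ∈ Finset.range n, (1 - y / (x + j) ^ 2) := by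
  rw [sqDiffProd, shiftedFactorial_eq_prod, ← Finset.prod_pow, ← Finset.prod_mul_distrib]
  refine Finset.prod_congr rfl fun j hj => ?_
  have := hx j (Finset.mem_range.1 hj)
  field_simp

theorem saalCoeff_eq_mul_prod (a y : ℚ) (n : ℕ) :
    saalCoeff a y n = shiftedFactorial (1 - a) n / (n.factorial : ℚ) *
      ∏ j ∈ Finset.range n, (1 - y / (1 + j) ^ 2)⁻¹ := by
  have hf : (n.factorial : ℚ) ≠ 0 := by positivity
  rw [saalCoeff, sqDiffProd_eq_mul_prod y fun j _ => by positivity, shiftedFactorial_one,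
    Finset.prod_inv_distrib]
  field_simp

theorem saalCoeff_zero_right (a : ℚ) (n : ℕ) :
    saalCoeff a 0 n = shiftedFactorial (1 - a) n / (n.factorial : ℚ) := by
  simp [saalCoeff_eq_mul_prod]

/-! ### The ℤ_(p)-span of the well-poised basis. -/

section span

variable {p : ℕ} {hp : p.Prime}

/-- The `ℤ_(p)`-module of functions spanned by the well-poised basis. -/
def wellPoisedSpan (p : ℕ) (hp : p.Prime) (a : ℚ) : Submodule (integralAt p hp) (ℕ → ℚ) :=
  Submodule.span (integralAt p hp) (Set.range (wellPoised a))

theorem wellPoised_mem_span (a : ℚ) (i : ℕ) : wellPoised a i ∈ wellPoisedSpan p hp a :=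
  Submodule.subset_span ⟨i, rfl⟩

theorem sum_mul_wellPoised_mem_span (a : ℚ) (S : Finset ℕ) (g : ℕ → ℕ) {c : ℕ → ℚ}
    (hc : ∀ i ∈ S, c i ∈ integralAt p hp) :
    (fun k => ∑ i ∈ S, c i * wellPoised a (g i) k) ∈ wellPoisedSpan p hp a := by
  have : (fun k => ∑ i ∈ S, c i * wellPoised a (g i) k) =
      ∑ i ∈ S, fun k => c i * wellPoised a (g i) k := by
    ext k
    rw [Finset.sum_apply]
  rw [this]
  exact sum_mem fun i hi => Submodule.smul_mem _ (⟨c i, hc i hi⟩ : integralAt p hp)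
    (wellPoised_mem_span a (g i))

/-- With g = j - h, the coefficient is (-1)^g C(i+h, h) C(i+h, j) (i+a+h)_g / g!, and it vanishes
for i < g. -/
theorem wellPoised_mul_coeff_mem_integralAt {a : ℚ} (ha : a ∈ integralAt p hp) {i j h : ℕ}
    (hj : h ≤ j) :
    ((i + h).factorial : ℚ) ^ 2 / ((i.factorial : ℚ) ^ 2 * (j.factorial : ℚ) ^ 2) *
      ((j.choose h : ℚ) * shiftedFactorial (-(i : ℚ)) (j - h) *
        shiftedFactorial (i + a + h) (j - h)) ∈ integralAt p hp := by
  rcases lt_or_ge i (j - h) with hi | hi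
  · rw [shiftedFactorial_neg_natCast_eq_zero hi]
    simp
  obtain ⟨g, rfl⟩ : ∃ g, j = h + g := ⟨j - h, by omega⟩
  rw [Nat.add_sub_cancel_left] at hi ⊢
  obtain ⟨l, rfl⟩ : ∃ l, i = l + g := ⟨i - g, by omega⟩
  have e1 := shiftedFactorial_neg_natCast (show g ≤ l + g by omega)
  rw [Nat.add_sub_cancel] at e1
  have c1 := Nat.add_choose_mul_factorial_mul_factorial (l + g) h
  have c2 := Nat.add_choose_mul_factorial_mul_factorial l (h + g)
  have c3 := Nat.add_choose_mul_factorial_mul_factorial h g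
  rw [show l + (h + g) = l + g + h by omega] at c2
  have c1' : ((l + g + h).choose h : ℚ) * (l + g).factorial * h.factorial =
    (l + g + h).factorial := by exact_mod_cast c1
  have c2' : ((l + g + h).choose (h + g) : ℚ) * l.factorial * (h + g).factorial =
    (l + g + h).factorial := by exact_mod_cast c2
  have c3' : ((h + g).choose h : ℚ) * h.factorial * g.factorial =
    (h + g).factorial := by
    rw [Nat.choose_symm_add]
    exact_mod_cast c3
  have : ((l + g + h).factorial : ℚ) ^ 2 / (((l + g).factorial : ℚ) ^ 2 *
      ((h + g).factorial : ℚ) ^ 2) * (((h + g).choose h : ℚ) *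
      shiftedFactorial (-((l + g : ℕ) : ℚ)) g *
        shiftedFactorial ((l + g : ℕ) + a + h) g) =
      (-1) ^ g * ((l + g + h).choose h : ℚ) * ((l + g + h).choose (h + g) : ℚ) *
        (shiftedFactorial ((l + g : ℕ) + a + h) g / (g.factorial : ℚ)) := by
    have f1 : ((l + g).factorial : ℚ) ≠ 0 := by positivity
    have f2 : (l.factorial : ℚ) ≠ 0 := by positivity
    have f3 : (g.factorial : ℚ) ≠ 0 := by positivity
    have f4 : (h.factorial : ℚ) ≠ 0 := by positivity
    have f5 : ((h + g).choose h : ℚ) ≠ 0 := by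
      exact_mod_cast (Nat.choose_pos (by omega)).ne'
    rw [eq_div_of_mul_eq f2 e1, sq ((l + g + h).factorial : ℚ)]
    nth_rw 1 [← c1']
    rw [← c2', ← c3']
    field_simp
  rw [this]
  refine mul_mem (mul_mem (mul_mem (pow_mem (neg_mem (one_mem _)) _) (natCast_mem _ _))
    (natCast_mem _ _)) (shiftedFactorial_div_factorial_mem_integralAt ?_ g)
  exact add_mem (add_mem (natCast_mem _ _) ha) (natCast_mem _ _)

theorem mul_mem_wellPoisedSpan {a : ℚ} (ha : a ∈ integralAt p hp) {f g : ℕ → ℚ}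
    (hf : f ∈ wellPoisedSpan p hp a) (hg : g ∈ wellPoisedSpan p hp a) :
    f * g ∈ wellPoisedSpan p hp a := by
  have hle : wellPoisedSpan p hp a * wellPoisedSpan p hp a ≤ wellPoisedSpan p hp a := by
    rw [wellPoisedSpan, Submodule.span_mul_span, Submodule.span_le]
    rintro _ ⟨_, ⟨i, rfl⟩, _, ⟨j, rfl⟩, rfl⟩
    have : wellPoised a i * wellPoised a j = fun k => ∑ h ∈ Finset.range (j + 1),
        ((i + h).factorial : ℚ) ^ 2 / ((i.factorial : ℚ) ^ 2 * (j.factorial : ℚ) ^ 2) *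
        ((j.choose h : ℚ) * shiftedFactorial (-(i : ℚ)) (j - h) *
        shiftedFactorial (i + a + h) (j - h)) * wellPoised a (i + h) k :=
      funext fun k => wellPoised_mul a i j k
    change wellPoised a i * wellPoised a j ∈ wellPoisedSpan p hp a
    rw [this]
    exact sum_mul_wellPoised_mem_span a _ (fun h => i + h) fun h hh =>
      wellPoised_mul_coeff_mem_integralAt ha (Nat.lt_succ_iff.1 (Finset.mem_range.1 hh))
  exact hle (Submodule.mul_mem_mul hf hg)

/-- Sums of very-well-poised type over an integral combination of the basis are divisible
by `q` whenever the length of the sum, or the reflected length, is. -/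
theorem sum_mem_wellPoisedSpan {a q : ℚ} (ha : a ∈ integralAt p hp) {n : ℕ}
    (hn : (∃ c ∈ integralAt p hp, (n : ℚ) = q * c) ∨
      ∃ c ∈ integralAt p hp, a + n - 1 = q * c)
    {f : ℕ → ℚ} (hf : f ∈ wellPoisedSpan p hp a) :
    ∃ c ∈ integralAt p hp, ∑ k ∈ Finset.range n, (2 * k + a) * f k = q * c := by
  induction hf using Submodule.span_induction with
  | mem f hf =>
    obtain ⟨i, rfl⟩ := hf
    have hn' : (n : ℚ) ∈ integralAt p hp := natCast_mem _ n
    rw [sum_wellPoised]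
    -- The leading factor, -n or a + n - 1, supplies q. The shortened shifted factorial is then
    -- paired with i!, the untouched one with (i+1)!.
    rcases hn with ⟨c, hc, h⟩ | ⟨c, hc, h⟩
    · refine ⟨c * (shiftedFactorial (-(n : ℚ) + 1) i / (i.factorial : ℚ)) *
        (shiftedFactorial (a + n - 1) (i + 1) / ((i + 1).factorial : ℚ)),
        mul_mem (mul_mem hc (shiftedFactorial_div_factorial_mem_integralAt
          (add_mem (neg_mem hn') (one_mem _)) i)) (shiftedFactorial_div_factorial_mem_integralAt
          (sub_mem (add_mem ha hn') (one_mem _)) (i + 1)), ?_⟩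
      rw [← mul_assoc, ← mul_assoc, ← h, shiftedFactorial_succ_left (-(n : ℚ))]
      ring
    · refine ⟨-c * (shiftedFactorial (-(n : ℚ)) (i + 1) / ((i + 1).factorial : ℚ)) *
        (shiftedFactorial (a + n - 1 + 1) i / (i.factorial : ℚ)),
        mul_mem (mul_mem (neg_mem hc) (shiftedFactorial_div_factorial_mem_integralAt
          (neg_mem hn') (i + 1))) (shiftedFactorial_div_factorial_mem_integralAt
          (add_mem (sub_mem (add_mem ha hn') (one_mem _)) (one_mem _)) i), ?_⟩
      rw [← mul_assoc, ← mul_assoc, mul_neg, ← h, shiftedFactorial_succ_left (a + n - 1)]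
      ring
  | zero => exact ⟨0, zero_mem _, by simp⟩
  | add f g _ _ hf hg =>
    obtain ⟨c, hc, h⟩ := hf
    obtain ⟨c', hc', h'⟩ := hg
    refine ⟨c + c', add_mem hc hc', ?_⟩
    simp only [Pi.add_apply, mul_add, Finset.sum_add_distrib, h, h']
  | smul x f _ hf =>
    obtain ⟨c, hc, h⟩ := hf
    refine ⟨x * c, mul_mem x.2 hc, ?_⟩
    rw [mul_left_comm, ← h, Finset.mul_sum]
    exact Finset.sum_congr rfl fun k _ => mul_left_comm _ _ _

theorem sq_sub_ne_zero_of_integralAt {y x : ℚ} (hx : x ≠ 0)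
    (h : ∃ w ∈ integralAt p hp, y / x ^ 2 = (p : ℚ) ^ 2 * w) : x ^ 2 - y ≠ 0 := by
  obtain ⟨w, hw, e⟩ := h
  have := (one_sub_mul_inv_mem_integralAt (mul_mem (natCast_mem (integralAt p hp) p) hw)).1
  rw [← mul_assoc, ← sq, ← e] at this
  intro h0
  apply this
  rw [← sub_eq_zero.1 h0, div_self (pow_ne_zero 2 hx), sub_self]

/-- The coefficients of u² and R agree modulo p², so the square gives p⁴ and the weighted summation
gives p^s. Stopping at j + 1 < n keeps the case n = p^s admissible. -/
theorem sum_sq_sub_mem_integralAt {a y : ℚ} (ha : a ∈ integralAt p hp) {n s : ℕ}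
    (hn : (∃ c ∈ integralAt p hp, (n : ℚ) = (p : ℚ) ^ s * c) ∨
      ∃ c ∈ integralAt p hp, a + n - 1 = (p : ℚ) ^ s * c)
    (hy : ∀ j : ℕ, j + 1 < n →
      ∃ w ∈ integralAt p hp, y / (1 + j : ℚ) ^ 2 = (p : ℚ) ^ 2 * w) :
    ∃ c ∈ integralAt p hp, ∑ k ∈ Finset.range n, (2 * k + a) *
      ((shiftedFactorial a k / (k.factorial : ℚ)) ^ 2 *
        ((shiftedFactorial a k / (k.factorial : ℚ)) ^ 2 -
          sqDiffProd a y k / sqDiffProd 1 y k) ^ 2) = (p : ℚ) ^ (s + 4) * c := by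
  have h1a : (1 - a) ∈ integralAt p hp := sub_mem (one_mem _) ha
  have hdiff : ∀ i < n, ∃ w ∈ integralAt p hp,
      saalCoeff a 0 i - saalCoeff a y i = (p : ℚ) ^ 2 * w := by
    intro i hi
    obtain ⟨⟨x, hx, ex⟩, -, ⟨z, hz, ez⟩⟩ := prod_one_sub_integralAt
      (f := fun j => y / (1 + j : ℚ) ^ 2) i fun j hj => hy j (by omega)
    refine ⟨-(shiftedFactorial (1 - a) i / (i.factorial : ℚ) * (x + (p : ℚ) ^ 2 * z)),
      neg_mem (mul_mem (shiftedFactorial_div_factorial_mem_integralAt h1a i)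
        (add_mem hx (mul_mem (pow_mem (natCast_mem _ p) 2) hz))), ?_⟩
    rw [saalCoeff_zero_right, saalCoeff_eq_mul_prod, ez, ex]
    ring
  choose! w hw ew using hdiff
  let F : ℕ → ℚ := fun k => ∑ i ∈ Finset.range n, saalCoeff a 0 i * wellPoised a i k
  let D : ℕ → ℚ := fun k => ∑ i ∈ Finset.range n, w i * wellPoised a i k
  have hF : F ∈ wellPoisedSpan p hp a :=
    sum_mul_wellPoised_mem_span a _ id fun i _ => by
      rw [saalCoeff_zero_right]
      exact shiftedFactorial_div_factorial_mem_integralAt h1a i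
  have hD : D ∈ wellPoisedSpan p hp a :=
    sum_mul_wellPoised_mem_span a _ id fun i hi => hw i (Finset.mem_range.1 hi)
  obtain ⟨c, hc, ec⟩ := sum_mem_wellPoisedSpan ha hn
    (mul_mem_wellPoisedSpan ha hF (mul_mem_wellPoisedSpan ha hD hD))
  refine ⟨c, hc, ?_⟩
  rw [pow_add, mul_right_comm, ← ec, Finset.sum_mul]
  refine Finset.sum_congr rfl fun k hk => ?_
  have hk' := Finset.mem_range.1 hk
  have eF : (shiftedFactorial a k / (k.factorial : ℚ)) ^ 2 = F k := by
    have := sqDiffProd_div_eq_sum a 0 hk' fun j _ => by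
      rw [sub_zero]; positivity
    rw [sqDiffProd_zero_right, sqDiffProd_zero_right, shiftedFactorial_one, ← div_pow] at this
    rw [this]
    exact Finset.sum_congr rfl fun i _ => mul_comm _ _
  have eD : F k - sqDiffProd a y k / sqDiffProd 1 y k = (p : ℚ) ^ 2 * D k := by
    rw [sqDiffProd_div_eq_sum a y hk' fun j hj =>
      sq_sub_ne_zero_of_integralAt (by positivity) (hy j hj)]
    simp only [F, D]
    rw [← Finset.sum_sub_distrib, Finset.mul_sum]
    refine Finset.sum_congr rfl fun i hi => ?_
    rw [← mul_assoc, ← ew i (Finset.mem_range.1 hi)]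
    ring
  rw [eF, eD]
  simp only [Pi.mul_apply]
  ring

end span

/-! ### Splitting the sixth power and comparing the closed form. -/

/-- The identity u⁶ = u²(u² - R)² + u² R (2u² - R), where the last part stops at k = N because R
vanishes beyond. -/
theorem sum_range_sixth_power_eq {a t : ℚ} {N n : ℕ} (hN : a + N = t) (hNn : N < n)
    (ha : ∀ j ≤ N, a + j ≠ 0) (hat : ∀ j < N, a + t + j ≠ 0)
    (ht : ∀ j < N, (1 + j : ℚ) ^ 2 - t ^ 2 ≠ 0) :
    ∑ k ∈ Finset.range n, (2 * k + a) * (shiftedFactorial a k / (k.factorial : ℚ)) ^ 6 =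
      (∑ k ∈ Finset.range n, (2 * k + a) * ((shiftedFactorial a k / (k.factorial : ℚ)) ^ 2 *
        ((shiftedFactorial a k / (k.factorial : ℚ)) ^ 2 -
          sqDiffProd a (t ^ 2) k / sqDiffProd 1 (t ^ 2) k) ^ 2)) +
      ∑ i ∈ Finset.range (N + 1), (2 * saalCoeff a 0 i - saalCoeff a (t ^ 2) i) *
        (t / (N.factorial : ℚ) * (shiftedFactorial (2 * a + i) (N - i) * (shiftedFactorial a i *
        sqDiffProd a (t ^ 2) i / (i.factorial : ℚ) ^ 2))) := by
  have hsub : Finset.range (N + 1) ⊆ Finset.range n := Finset.range_mono hNn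
  have hvanish : ∀ k, N < k → sqDiffProd a (t ^ 2) k = 0 := fun k hk =>
    Finset.prod_eq_zero (Finset.mem_range.2 hk) (by rw [hN, sub_self])
  have e1 : ∑ i ∈ Finset.range (N + 1), (2 * saalCoeff a 0 i - saalCoeff a (t ^ 2) i) *
        (t / (N.factorial : ℚ) * (shiftedFactorial (2 * a + i) (N - i) * (shiftedFactorial a i *
        sqDiffProd a (t ^ 2) i / (i.factorial : ℚ) ^ 2))) =
      ∑ k ∈ Finset.range (N + 1), (2 * k + a) * termWeight a (t ^ 2) k *
        (2 * (shiftedFactorial a k / (k.factorial : ℚ)) ^ 2 -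
          sqDiffProd a (t ^ 2) k / sqDiffProd 1 (t ^ 2) k) := by
    have h1 : ∀ i ∈ Finset.range (N + 1), (2 * saalCoeff a 0 i - saalCoeff a (t ^ 2) i) *
        (t / (N.factorial : ℚ) * (shiftedFactorial (2 * a + i) (N - i) * (shiftedFactorial a i *
        sqDiffProd a (t ^ 2) i / (i.factorial : ℚ) ^ 2))) =
        ∑ k ∈ Finset.range (N + 1), (2 * k + a) * termWeight a (t ^ 2) k *
          (2 * (wellPoised a i k * saalCoeff a 0 i) -
            wellPoised a i k * saalCoeff a (t ^ 2) i) := by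
      intro i hi
      rw [← sum_termWeight_wellPoised hN ha hat ht (Nat.lt_succ_iff.1 (Finset.mem_range.1 hi)),
        Finset.mul_sum]
      exact Finset.sum_congr rfl fun k _ => by ring
    rw [Finset.sum_congr rfl h1, Finset.sum_comm]
    refine Finset.sum_congr rfl fun k hk => ?_
    have hk' := Finset.mem_range.1 hk
    have h2 := sqDiffProd_div_eq_sum a 0 hk' fun j _ => by rw [sub_zero]; positivity
    rw [sqDiffProd_zero_right, sqDiffProd_zero_right, shiftedFactorial_one, ← div_pow] at h2
    rw [← Finset.mul_sum, h2, sqDiffProd_div_eq_sum a (t ^ 2) hk' fun j hj => ht j (by omega),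
      Finset.sum_sub_distrib, ← Finset.mul_sum]
  have e2 : ∑ k ∈ Finset.range (N + 1), (2 * k + a) * termWeight a (t ^ 2) k *
        (2 * (shiftedFactorial a k / (k.factorial : ℚ)) ^ 2 -
          sqDiffProd a (t ^ 2) k / sqDiffProd 1 (t ^ 2) k) =
      ∑ k ∈ Finset.range n, (2 * k + a) * termWeight a (t ^ 2) k *
        (2 * (shiftedFactorial a k / (k.factorial : ℚ)) ^ 2 -
          sqDiffProd a (t ^ 2) k / sqDiffProd 1 (t ^ 2) k) := by
    refine Finset.sum_subset hsub fun k _ hk => ?_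
    rw [termWeight, hvanish k (by rw [Finset.mem_range] at hk; omega)]
    simp
  rw [e1, e2, ← Finset.sum_add_distrib]
  refine Finset.sum_congr rfl fun k _ => ?_
  rw [termWeight]
  ring

theorem sum_Icc_one_eq_sum_range (f : ℕ → ℚ) (k : ℕ) :
    ∑ j ∈ Finset.Icc 1 k, f j = ∑ j ∈ Finset.range k, f (j + 1) := by
  induction k with
  | zero => simp
  | succ k ih => rw [Finset.sum_Icc_succ_top (by omega), ih, Finset.sum_range_succ]

/-- Up to sign this is the product of (a+j)/(-N+j) = 1 - t/(N-j) over j < i. It absorbs the N! in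
the denominator of the final sum. -/
theorem shiftedFactorial_mul_factorial_sub_div_mem_integralAt {p : ℕ} {hp : p.Prime} {a t : ℚ}
    {N : ℕ} (hN : a + N = t)
    (h : ∀ j < N, ∃ w ∈ integralAt p hp, t / (N - j) = w) {i : ℕ} (hi : i ≤ N) :
    shiftedFactorial a i * ((N - i).factorial : ℚ) / (N.factorial : ℚ) ∈ integralAt p hp := by
  have hj : ∀ j < i, (-(N : ℚ) + j) ≠ 0 := fun j hj h0 => by
    have : (j : ℚ) = N := by linarith
    have := Nat.cast_injective (R := ℚ) this
    omega
  have e1 := shiftedFactorial_neg_natCast hi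
  have h0 : shiftedFactorial (-(N : ℚ)) i ≠ 0 := by
    rw [shiftedFactorial_eq_prod]
    exact Finset.prod_ne_zero_iff.2 fun j hh => hj j (Finset.mem_range.1 hh)
  have h1 : (N.factorial : ℚ) ≠ 0 := by positivity
  have h2 : ((-1 : ℚ)) ^ i * (-1) ^ i = 1 := by rw [← mul_pow]; norm_num
  have e2 : shiftedFactorial a i * ((N - i).factorial : ℚ) / (N.factorial : ℚ) =
      (-1) ^ i * (shiftedFactorial a i / shiftedFactorial (-(N : ℚ)) i) := by
    field_simp
    linear_combination shiftedFactorial a i * e1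
  rw [e2, shiftedFactorial_eq_prod, shiftedFactorial_eq_prod, ← Finset.prod_div_distrib]
  refine mul_mem (pow_mem (neg_mem (one_mem _)) _) (prod_mem fun j hh => ?_)
  have hji := Finset.mem_range.1 hh
  obtain ⟨w, hw, ew⟩ := h j (by omega)
  have : (a + j) / (-(N : ℚ) + j) = 1 - w := by
    have h3 := hj j hji
    have h4 : (N : ℚ) - j ≠ 0 := fun h => h3 (by linarith)
    rw [← ew, ← hN]
    field_simp
    ring
  rw [this]
  exact sub_mem (one_mem _) hw

theorem sum_terms_congr {p : ℕ} {hp : p.Prime} {a t D : ℚ} {N s : ℕ}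
    (ha : a ∈ integralAt p hp) (hD : D * t = (p : ℚ) ^ s) (hN : a + N = t)
    (h₁ : ∀ j < N, ∃ w ∈ integralAt p hp, t ^ 2 / (1 + j : ℚ) ^ 2 = (p : ℚ) ^ 2 * w)
    (h₂ : ∀ j < N, ∃ w ∈ integralAt p hp, t ^ 2 / (a + j) ^ 2 = (p : ℚ) ^ 2 * w)
    (h₃ : ∀ j < N, ∃ w ∈ integralAt p hp, t / (N - j) = w) (ha0 : ∀ j < N, a + j ≠ 0) :
    ∃ c ∈ integralAt p hp, D * ∑ i ∈ Finset.range (N + 1),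
        (2 * saalCoeff a 0 i - saalCoeff a (t ^ 2) i) *
        (t / (N.factorial : ℚ) * (shiftedFactorial (2 * a + i) (N - i) * (shiftedFactorial a i *
        sqDiffProd a (t ^ 2) i / (i.factorial : ℚ) ^ 2))) -
      1 / (N.factorial : ℚ) * ∑ i ∈ Finset.range (N + 1), shiftedFactorial (2 * a + i) (N - i) *
        (shiftedFactorial a i ^ 3 * shiftedFactorial (1 - a) i / (i.factorial : ℚ) ^ 3) *
        ((p : ℚ) ^ s * (1 - ∑ j ∈ Finset.range i, t ^ 2 / (1 + j : ℚ) ^ 2 -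
          ∑ j ∈ Finset.range i, t ^ 2 / (a + j) ^ 2)) = (p : ℚ) ^ (s + 4) * c := by
  have hpm : (p : ℚ) ∈ integralAt p hp := natCast_mem _ p
  have key : ∀ i ∈ Finset.range (N + 1), ∃ c ∈ integralAt p hp,
      D * ((2 * saalCoeff a 0 i - saalCoeff a (t ^ 2) i) *
        (t / (N.factorial : ℚ) * (shiftedFactorial (2 * a + i) (N - i) * (shiftedFactorial a i *
        sqDiffProd a (t ^ 2) i / (i.factorial : ℚ) ^ 2)))) -
      1 / (N.factorial : ℚ) * (shiftedFactorial (2 * a + i) (N - i) *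
        (shiftedFactorial a i ^ 3 * shiftedFactorial (1 - a) i / (i.factorial : ℚ) ^ 3) *
        ((p : ℚ) ^ s * (1 - ∑ j ∈ Finset.range i, t ^ 2 / (1 + j : ℚ) ^ 2 -
          ∑ j ∈ Finset.range i, t ^ 2 / (a + j) ^ 2))) = (p : ℚ) ^ (s + 4) * c := by
    intro i hi
    have hiN : i ≤ N := Nat.lt_succ_iff.1 (Finset.mem_range.1 hi)
    obtain ⟨⟨x, hx, ex⟩, -, ⟨z, hz, ez⟩⟩ := prod_one_sub_integralAt
      (f := fun j => t ^ 2 / (1 + j : ℚ) ^ 2) i fun j hj => h₁ j (by omega)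
    obtain ⟨⟨x', hx', ex'⟩, ⟨z', hz', ez'⟩, -⟩ := prod_one_sub_integralAt
      (f := fun j => t ^ 2 / (a + j : ℚ) ^ 2) i fun j hj => h₂ j (by omega)
    -- The common factor of both terms; inserting (N-i)! above and below makes each piece
    -- p-integral.
    let X : ℚ := shiftedFactorial (2 * a + i) (N - i) / ((N - i).factorial : ℚ) *
      (shiftedFactorial (1 - a) i / (i.factorial : ℚ)) *
      (shiftedFactorial a i / (i.factorial : ℚ)) ^ 2 *
      (shiftedFactorial a i * ((N - i).factorial : ℚ) / (N.factorial : ℚ))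
    have hX : X ∈ integralAt p hp := by
      refine mul_mem (mul_mem (mul_mem ?_ ?_) (pow_mem ?_ 2))
        (shiftedFactorial_mul_factorial_sub_div_mem_integralAt hN h₃ hiN)
      · rw [two_mul]
        exact shiftedFactorial_div_factorial_mem_integralAt
          (add_mem (add_mem ha ha) (natCast_mem _ _)) _
      · exact shiftedFactorial_div_factorial_mem_integralAt (sub_mem (one_mem _) ha) _
      · exact shiftedFactorial_div_factorial_mem_integralAt ha _
    -- The p⁴-coefficient of (1 - p²x - p⁴z)(1 - p²x' + p⁴z') beyond 1 - p²x - p²x'.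
    refine ⟨X * (x * x' + z' - z * (1 - (p : ℚ) ^ 2 * x' + (p : ℚ) ^ 4 * z') -
      (p : ℚ) ^ 2 * x * z'), mul_mem hX (sub_mem (sub_mem (add_mem (mul_mem hx hx') hz')
        (mul_mem hz (add_mem (sub_mem (one_mem _) (mul_mem (pow_mem hpm 2) hx'))
          (mul_mem (pow_mem hpm 4) hz')))) (mul_mem (mul_mem (pow_mem hpm 2) hx) hz')), ?_⟩
    have f1 : (i.factorial : ℚ) ≠ 0 := by positivity
    have f2 : (N.factorial : ℚ) ≠ 0 := by positivity
    have f3 : ((N - i).factorial : ℚ) ≠ 0 := by positivity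
    rw [saalCoeff_zero_right, saalCoeff_eq_mul_prod,
      sqDiffProd_eq_mul_prod (t ^ 2) fun j hj => ha0 j (by omega), ez, ez', ex, ex']
    have hXe : X = shiftedFactorial (2 * a + i) (N - i) * shiftedFactorial (1 - a) i *
        shiftedFactorial a i ^ 3 / ((i.factorial : ℚ) ^ 3 * N.factorial) := by
      simp only [X]
      field_simp
    rw [hXe, pow_add, ← hD]
    field_simp
    ring
  choose! c hc ec using key
  refine ⟨∑ i ∈ Finset.range (N + 1), c i, sum_mem hc, ?_⟩
  rw [Finset.mul_sum, Finset.mul_sum, Finset.mul_sum, ← Finset.sum_sub_distrib]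
  exact Finset.sum_congr rfl ec

theorem corollary5p3 (p d s : ℕ) (r : ℤ) (hp : p.Prime) (hp2 : p ≠ 2) (hd : 0 < d) (hs : 0 < s)
    (hr₁ : (d : ℤ) + (p : ℤ) ^ s - (d : ℤ) * (p : ℤ) ^ s ≤ r) (hr₂ : r ≤ (p : ℤ) ^ s)
    (hpd : Nat.gcd p d = 1) (hmod : (p : ℤ) ^ s ≡ r [ZMOD (d : ℤ)])
    (N : ℕ) (hN : (N : ℤ) = ((p : ℤ) ^ s - r) / (d : ℤ))
    (m : ℕ) (hm : m = N ∨ m = p ^ s - 1) :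
    RatCongr p (s + 4)
      (∑ k ∈ Finset.range (m + 1),
        (2 * (d : ℚ) * (k : ℚ) + (r : ℚ)) *
          (shiftedFactorial ((r : ℚ) / (d : ℚ)) k ^ 6 / (Nat.factorial k : ℚ) ^ 6))
      (1 / shiftedFactorial 1 N *
        ∑ k ∈ Finset.range (N + 1),
          shiftedFactorialQuot (2 * (r : ℚ) / (d : ℚ)) N k *
            (shiftedFactorial ((r : ℚ) / (d : ℚ)) k ^ 3 *
              shiftedFactorial (1 - (r : ℚ) / (d : ℚ)) k / (Nat.factorial k : ℚ) ^ 3) *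
            ((p : ℚ) ^ s - (p : ℚ) ^ (3 * s) *
              ∑ j ∈ Finset.Icc 1 k,
                (1 / ((d : ℚ) * (j : ℚ)) ^ 2 +
                  1 / ((d : ℚ) * (j : ℚ) - (d : ℚ) + (r : ℚ)) ^ 2))) := by
  have hpi := Nat.prime_iff_prime_int.1 hp
  have hpos : 0 < p ^ s := Nat.pow_pos hp.pos
  have hposZ : (0 : ℤ) < (p : ℤ) ^ s := by exact_mod_cast hpos
  have hdZ : (0 : ℤ) < d := by exact_mod_cast hd
  have hd0 : (d : ℚ) ≠ 0 := by exact_mod_cast hd.ne'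
  have hp0 : (p : ℚ) ≠ 0 := by exact_mod_cast hp.ne_zero
  have hdN : (d : ℤ) * N = (p : ℤ) ^ s - r := by
    rw [hN, mul_comm]
    exact Int.ediv_mul_cancel hmod.symm.dvd
  have hNlt : N < p ^ s := by
    have h1 : (d : ℤ) * (N + 1) ≤ d * (p : ℤ) ^ s := by rw [mul_add, hdN]; linarith
    have h2 := le_of_mul_le_mul_left h1 hdZ
    zify
    omega
  have hmlt : m < p ^ s := by omega
  have hNm : N < m + 1 := by omega
  have hpd' : ¬ (p : ℤ) ∣ d := by
    rw [Int.natCast_dvd_natCast]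
    exact (Nat.Prime.coprime_iff_not_dvd hp).1 hpd
  have hndvd : ∀ l : ℤ, 0 < l → l < (p : ℤ) ^ s → ¬ (p : ℤ) ^ s ∣ d * l := by
    intro l hl hl' h
    have hc : IsCoprime ((p : ℤ) ^ s) d := ((hpi.coprime_iff_not_dvd).2 hpd').pow_left
    exact absurd (Int.le_of_dvd hl (hc.dvd_of_dvd_mul_left h)) (by omega)
  have hNZ : (N : ℤ) < (p : ℤ) ^ s := by exact_mod_cast hNlt
  -- Here r + dj = p^s - d(N - j) with 0 < N - j < p^s.
  have hrj : ∀ j < N, ¬ (p : ℤ) ^ s ∣ r + d * j := by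
    intro j hj h
    refine hndvd (N - j) (by omega) (by omega) ?_
    rw [mul_sub, hdN, show (p : ℤ) ^ s - r - d * j = (p : ℤ) ^ s - (r + d * j) by ring]
    exact dvd_sub (dvd_refl _) h
  set a : ℚ := (r : ℚ) / d with ha_def
  set t : ℚ := (p : ℚ) ^ s / d with ht_def
  have hD : (d : ℚ) * t = (p : ℚ) ^ s := by rw [ht_def]; field_simp
  have hda : (d : ℚ) * a = r := by rw [ha_def]; field_simp
  have ha : a ∈ integralAt p hp := div_intCast_mem_integralAt r hpd'
  have hNQ : (d : ℚ) * N = (p : ℚ) ^ s - r := by exact_mod_cast hdN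
  have haN : a + N = t := by
    apply mul_left_cancel₀ hd0
    rw [mul_add, hda, hNQ, hD]
    ring
  have haj : ∀ j : ℕ, (d : ℚ) * (a + j) = ((r + d * j : ℤ) : ℚ) := fun j => by
    push_cast; rw [mul_add, hda]
  have ht0 : t ≠ 0 := div_ne_zero (pow_ne_zero _ hp0) hd0
  have ha0 : ∀ j < N, a + j ≠ 0 := by
    intro j hj h
    have h1 := haj j
    rw [h, mul_zero] at h1
    apply hrj j hj
    rw [Int.cast_eq_zero.1 h1.symm]
    exact dvd_zero _
  have ha0' : ∀ j ≤ N, a + j ≠ 0 := by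
    intro j hj
    rcases hj.lt_or_eq with h | rfl
    · exact ha0 j h
    · rw [haN]; exact ht0
  have hat : ∀ j < N, a + t + j ≠ 0 := by
    intro j hj h
    have h1 : (d : ℚ) * (a + t + j) = ((r + d * j + (p : ℤ) ^ s : ℤ) : ℚ) := by
      push_cast
      linear_combination hda + hD
    rw [h, mul_zero] at h1
    apply hrj j hj
    rw [eq_neg_of_add_eq_zero_left (Int.cast_eq_zero.1 h1.symm)]
    exact (dvd_refl _).neg_right
  have hq : ∀ z : ℤ, ¬ (p : ℤ) ^ s ∣ z → ∃ w ∈ integralAt p hp,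
      ((p : ℚ) ^ s / z) ^ 2 = (p : ℚ) ^ 2 * w := by
    intro z hz
    obtain ⟨x, hx, e⟩ := pow_div_intCast_mem_integralAt (hp := hp) hz
    exact ⟨x ^ 2, pow_mem hx 2, by rw [e, mul_pow]⟩
  have h₁ : ∀ j : ℕ, j + 1 < p ^ s →
      ∃ w ∈ integralAt p hp, t ^ 2 / (1 + j : ℚ) ^ 2 = (p : ℚ) ^ 2 * w := by
    intro j hj
    have hj' : (j : ℤ) + 1 < (p : ℤ) ^ s := by exact_mod_cast hj
    obtain ⟨w, hw, e⟩ := hq (d * (j + 1)) (hndvd _ (by omega) hj')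
    refine ⟨w, hw, ?_⟩
    rw [← e, ← div_pow, ht_def]
    push_cast
    rw [div_div, add_comm (1 : ℚ)]
  have h₂ : ∀ j < N, ∃ w ∈ integralAt p hp, t ^ 2 / (a + j) ^ 2 = (p : ℚ) ^ 2 * w := by
    intro j hj
    obtain ⟨w, hw, e⟩ := hq _ (hrj j hj)
    refine ⟨w, hw, ?_⟩
    rw [← e, ← haj, ← div_pow, ht_def, div_div]
  have h₃ : ∀ j < N, ∃ w ∈ integralAt p hp, t / (N - j) = w := by
    intro j hj
    obtain ⟨x, hx, e⟩ := pow_div_intCast_mem_integralAt (hp := hp)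
      (hndvd (N - j) (by omega) (by omega))
    refine ⟨p * x, mul_mem (natCast_mem _ p) hx, ?_⟩
    rw [← e, ht_def, div_div]
    push_cast
    rfl
  have hn : (∃ c ∈ integralAt p hp, ((m + 1 : ℕ) : ℚ) = (p : ℚ) ^ s * c) ∨
      ∃ c ∈ integralAt p hp, a + ((m + 1 : ℕ) : ℚ) - 1 = (p : ℚ) ^ s * c := by
    -- For m = N the reflected length a + N = p^s/d is divisible by p^s; for m = p^s - 1 the length
    -- itself is p^s.
    rcases hm with rfl | rfl
    · refine .inr ⟨_, div_intCast_mem_integralAt 1 hpd', ?_⟩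
      push_cast
      rw [← add_assoc, add_sub_cancel_right, haN, ht_def, mul_one_div]
    · refine .inl ⟨1, one_mem _, ?_⟩
      rw [Nat.sub_add_cancel hpos]
      push_cast
      ring
  obtain ⟨c₁, hc₁, e₁⟩ := sum_sq_sub_mem_integralAt (y := t ^ 2) ha hn
    fun j hj => h₁ j (by omega)
  obtain ⟨c₂, hc₂, e₂⟩ := sum_terms_congr ha hD haN (fun j hj => h₁ j (by omega)) h₂ h₃ ha0
  have e₃ := sum_range_sixth_power_eq haN hNm ha0' hat fun j hj =>
    sq_sub_ne_zero_of_integralAt (p := p) (hp := hp) (by positivity) (h₁ j (by omega))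
  rw [ratCongr_iff (hp := hp)]
  refine ⟨d * c₁ + c₂, add_mem (mul_mem (natCast_mem _ d) hc₁) hc₂, ?_⟩
  have hlhs : ∑ k ∈ Finset.range (m + 1), (2 * (d : ℚ) * (k : ℚ) + (r : ℚ)) *
      (shiftedFactorial a k ^ 6 / (Nat.factorial k : ℚ) ^ 6) =
      (d : ℚ) * ∑ k ∈ Finset.range (m + 1),
        (2 * k + a) * (shiftedFactorial a k / (k.factorial : ℚ)) ^ 6 := by
    rw [Finset.mul_sum]
    refine Finset.sum_congr rfl fun k _ => ?_
    rw [← hda, div_pow]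
    ring
  have hrhs : ∀ k ∈ Finset.range (N + 1), shiftedFactorialQuot (2 * (r : ℚ) / (d : ℚ)) N k *
            (shiftedFactorial a k ^ 3 *
              shiftedFactorial (1 - a) k / (Nat.factorial k : ℚ) ^ 3) *
            ((p : ℚ) ^ s - (p : ℚ) ^ (3 * s) *
              ∑ j ∈ Finset.Icc 1 k,
                (1 / ((d : ℚ) * (j : ℚ)) ^ 2 +
                  1 / ((d : ℚ) * (j : ℚ) - (d : ℚ) + (r : ℚ)) ^ 2)) =
      shiftedFactorial (2 * a + k) (N - k) *
        (shiftedFactorial a k ^ 3 * shiftedFactorial (1 - a) k / (k.factorial : ℚ) ^ 3) *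
        ((p : ℚ) ^ s * (1 - ∑ j ∈ Finset.range k, t ^ 2 / (1 + j : ℚ) ^ 2 -
          ∑ j ∈ Finset.range k, t ^ 2 / (a + j) ^ 2)) := by
    intro k _
    have hsum : (p : ℚ) ^ (3 * s) * ∑ j ∈ Finset.Icc 1 k, (1 / ((d : ℚ) * (j : ℚ)) ^ 2 +
        1 / ((d : ℚ) * (j : ℚ) - (d : ℚ) + (r : ℚ)) ^ 2) =
        (p : ℚ) ^ s * (∑ j ∈ Finset.range k, t ^ 2 / (1 + j : ℚ) ^ 2 +
          ∑ j ∈ Finset.range k, t ^ 2 / (a + j) ^ 2) := by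
      rw [sum_Icc_one_eq_sum_range, ← Finset.sum_add_distrib, Finset.mul_sum, Finset.mul_sum]
      refine Finset.sum_congr rfl fun j _ => ?_
      have e₁ : (d : ℚ) * ((j + 1 : ℕ) : ℚ) - d + r = d * (a + j) := by
        push_cast
        rw [← hda]
        ring
      have e₂ : ((j + 1 : ℕ) : ℚ) = 1 + j := by push_cast; ring
      have e₃ : t ^ 2 = ((p : ℚ) ^ s) ^ 2 / (d : ℚ) ^ 2 := by rw [ht_def, div_pow]
      rw [e₁, e₂, e₃, pow_mul', mul_pow, mul_pow]
      simp only [div_eq_mul_inv, mul_inv]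
      ring
    rw [shiftedFactorialQuot, mul_div_assoc, ← ha_def, hsum]
    ring
  rw [hlhs, Finset.sum_congr rfl hrhs, shiftedFactorial_one, e₃, mul_add, e₁, add_sub_assoc, e₂]
  ring
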